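/- Let $H\in\mathbb{R}^{M\times N}$ have columns indexed by $\mathcal V$ ($|\mathcal V|=N$), let $\mathcal L$ be a set of rows (the load measurements) and let $\Lambda_i\subseteq\mathcal V$ be a nonempty known attack support. Write $H_{\mathcal L,\mathcal V}$ for the submatrix of $H$ with rows $\mathcal L$ and all columns, and $H_{\mathcal L,\Lambda_i}$ for the one with rows $\mathcal L$ and columns $\Lambda_i$. Assume that $H_{\mathcal L,\Lambda_i}$ has full column rank and put $P_{\Lambda_i}=H_{\mathcal L,\Lambda_i}(H_{\mathcal L,\Lambda_i}^TH_{\mathcal L,\Lambda_i})^{-1}H_{\mathcal L,\Lambda_i}^T$. Let $\sigma_e>0$, let $\Delta e_{\mathcal L}\sim\mathcal N(0,\sigma_e^2I)$, and consider the binary test $$\mathcal H_0:\ \Delta z_{\mathcal L}=H_{\mathcal L,\mathcal V}\Delta\theta+\Delta e_{\mathcal L},\qquad \mathcal H_i:\ \Delta z_{\mathcal L}=H_{\mathcal L,\Lambda_i}c+H_{\mathcal L,\mathcal V}\Delta\theta+\Delta e_{\mathcal L}\ \text{ with }\ P_{\Lambda_i}H_{\mathcal L,\mathcal V}\Delta\theta=0,$$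 with unknown attack $c\in\mathbb{R}^{\Lambda_i}$ and state change $\Delta\theta\in\mathbb{R}^{\mathcal V}$. (i) Let $f(z;m)$ be the density of $\mathcal N(m,\sigma_e^2I)$ at $z$. For every $z\in\mathbb{R}^{\mathcal L}$ and every $\Delta\theta$ with $P_{\Lambda_i}H_{\mathcal L,\mathcal V}\Delta\theta=0$, the generalized likelihood ratio statistic, with $c$ maximized out, is $$2\ln\frac{\sup_{c}f(z;H_{\mathcal L,\Lambda_i}c+H_{\mathcal L,\mathcal V}\Delta\theta)}{f(z;H_{\mathcal L,\mathcal V}\Delta\theta)}=T(z):=\frac1{\sigma_e^2}\|P_{\Lambda_i}z\|^2 .$$ Accordingly the GLRT with threshold $\gamma\ge 0$ decides $\mathcal H_i$ when $T(\Delta z_{\mathcal L})>\gamma$. (ii) Let the actual load change $\Delta\theta$ satisfy $\|H_{\mathcal L,\mathcal V}\Delta\theta\|^2<\eta$ (the constraint $P_{\Lambda_i}H_{\mathcal L,\mathcal V}\Delta\theta=0$ is not required here). Then the false-alarm probability $P_{fa}=\Pr\big(T(H_{\mathcal L,\mathcal V}\Delta\theta+\Delta e_{\mathcal L})>\gamma\big)$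 satisfies $$Q_{|\Lambda_i|/2}\big(0,\sqrt\gamma\big)\ \le\ P_{fa}\ \le\ Q_{|\Lambda_i|/2}\Big(\frac{\sqrt\eta}{\sigma_e},\sqrt\gamma\Big),$$ where $Q_v(a,b)=a^{1-v}\int_b^\infty t^ve^{-(t^2+a^2)/2}I_{v-1}(at)\,dt$ for $a>0$ is the generalized Marcum $Q$-function, $I_{v-1}$ is the modified Bessel function of the first kind, and $Q_v(0,b)=\frac{1}{2^{v-1}\Gamma(v)}\int_b^\infty t^{2v-1}e^{-t^2/2}\,dt$ is its continuous extension to $a=0$. -/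

import Mathlib

open MeasureTheory ProbabilityTheory

namespace FDI

noncomputable section

/-- Modified Bessel function of the first kind of real order `μ`,
`I_μ(x) = ∑ₖ (x/2)^(2k+μ) / (k! Γ(k+μ+1))`, for `x > 0`. -/
def besselI (μ x : ℝ) : ℝ :=
  ∑' k : ℕ, (x / 2) ^ (2 * (k : ℝ) + μ) / ((k.factorial : ℝ) * Real.Gamma ((k : ℝ) + μ + 1))

/-- Generalized Marcum `Q`-function of real order `v > 0`, for `a, b ≥ 0`:
`Q_v(a, b) = a^(1-v) ∫_b^∞ t^v exp(-(t² + a²)/2) I_{v-1}(a t) dt` for `a > 0`, with its continuous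
extension `Q_v(0, b) = (2^(v-1) Γ(v))⁻¹ ∫_b^∞ t^(2v-1) exp(-t²/2) dt` at `a = 0`. -/
def marcumQ (v a b : ℝ) : ℝ :=
  if a = 0 then
    ((2 : ℝ) ^ (v - 1) * Real.Gamma v)⁻¹ *
      ∫ t in Set.Ioi b, t ^ (2 * v - 1) * Real.exp (-t ^ 2 / 2)
  else
    a ^ (1 - v) *
      ∫ t in Set.Ioi b, t ^ v * Real.exp (-(t ^ 2 + a ^ 2) / 2) * besselI (v - 1) (a * t)

variable {M V : Type*} [Fintype M] [DecidableEq M] [Fintype V] [DecidableEq V]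

/-- `H_{L,V}`: the rows of `H` indexed by the set `L` of load measurements. -/
def loadMatrix (H : Matrix M V ℝ) (L : Finset M) : Matrix L V ℝ :=
  H.submatrix (fun l : L => (l : M)) id

/-- `H_{L,Λ}`: the rows of `H` indexed by `L` and the columns indexed by the support `Λ`. -/
def attackMatrix (H : Matrix M V ℝ) (L : Finset M) (Λ : Finset V) : Matrix L Λ ℝ :=
  H.submatrix (fun l : L => (l : M)) (fun n : Λ => (n : V))

/-- `P_Λ = A (Aᵀ A)⁻¹ Aᵀ` with `A = H_{L,Λ}`. -/
def attackProj (H : Matrix M V ℝ) (L : Finset M) (Λ : Finset V) : Matrix L L ℝ :=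
  attackMatrix H L Λ * ((attackMatrix H L Λ).transpose * attackMatrix H L Λ)⁻¹ *
    (attackMatrix H L Λ).transpose

/-- Density at `z` of the law `N(m, σ² I)` on `ℝ^L`. -/
def gaussianLikelihood {L : Finset M} (σ : ℝ) (m z : EuclideanSpace ℝ L) : ℝ :=
  (2 * Real.pi * σ ^ 2) ^ (-((L.card : ℝ) / 2)) * Real.exp (-‖z - m‖ ^ 2 / (2 * σ ^ 2))

/-- Twice the logarithm of the generalized likelihood ratio
`sup_c f(z ; H_{L,Λ} c + H_{L,V} Δθ) / f(z ; H_{L,V} Δθ)`: the attack `c` with support `Λ` is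
unknown and maximized out, and `Δθ` is the nuisance state change. -/
def logGLR (H : Matrix M V ℝ) (L : Finset M) (Λ : Finset V) (σ : ℝ)
    (Δθ : EuclideanSpace ℝ V) (z : EuclideanSpace ℝ L) : ℝ :=
  2 * Real.log
    ((⨆ c : EuclideanSpace ℝ Λ, gaussianLikelihood σ
        ((attackMatrix H L Λ).toEuclideanLin c + (loadMatrix H L).toEuclideanLin Δθ) z) /
      gaussianLikelihood σ ((loadMatrix H L).toEuclideanLin Δθ) z)

/-- The test statistic `T(z) = σ⁻² ‖P_Λ z‖²`. -/
def glrtStat (H : Matrix M V ℝ) (L : Finset M) (Λ : Finset V) (σ : ℝ)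
    (z : EuclideanSpace ℝ L) : ℝ :=
  1 / σ ^ 2 * ‖(attackProj H L Λ).toEuclideanLin z‖ ^ 2

/-- The measurement difference under the null hypothesis (no attack),
`Δz_L = H_{L,V} Δθ + Δe_L`. -/
def nullMeasurement {Ω : Type*} (H : Matrix M V ℝ) (L : Finset M) (Δθ : EuclideanSpace ℝ V)
    (e : Ω → EuclideanSpace ℝ L) (ω : Ω) : EuclideanSpace ℝ L :=
  (loadMatrix H L).toEuclideanLin Δθ + e ω

/-- Probability of false alarm: under the null hypothesis, the probability that the test declares
an attack, i.e. that the statistic exceeds the threshold `γ`. -/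
def falseAlarmProb {Ω : Type*} [MeasurableSpace Ω] (P : Measure Ω) (H : Matrix M V ℝ)
    (L : Finset M) (Λ : Finset V) (σ γ : ℝ) (Δθ : EuclideanSpace ℝ V)
    (e : Ω → EuclideanSpace ℝ L) : ℝ :=
  P.real {ω | γ < glrtStat H L Λ σ (nullMeasurement H L Δθ e ω)}

end

end FDI

namespace FDI

/-! For (i), completing the square splits the residual orthogonally along the column space of
$H_{\mathcal L,\Lambda}$. The best attack cancels the projected part, so the supremum is attained
and only $\|P_\Lambda z\|^2$ survives in the ratio (`iSup_gaussianLikelihood`).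

For (ii), dividing by $\sigma$ turns the statistic into $\|P_\Lambda(m+x)\|^2$ with $x$ standard
Gaussian and $m=\sigma^{-1}H_{\mathcal L,\mathcal V}\Delta\theta$. As $P_\Lambda$ is an orthogonal
projection of trace $|\Lambda|$, this is noncentral chi-squared with $|\Lambda|$ degrees of freedom
and noncentrality $\|P_\Lambda m\|^2$ (`map_norm_sq_projection_stdGaussian`). Its tail at $b^2$ with
noncentrality $a^2$ is $Q_{|\Lambda|/2}(a,b)$ (`marcumQ_eq_noncentralChiSq`). The tail increases
with the noncentrality (`noncentralChiSq_Ioi_mono`), which lies between $0$ and $\eta/\sigma^2$.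

Laws are identified through $E\,e^{sX}$ for $s<1/2$. -/

/-! ### Uniqueness of a measure given its exponential moments. -/

open Filter Topology Complex in
theorem measure_ext_of_mgf_eq_on_Iio {μ ν : Measure ℝ} [IsFiniteMeasure μ] [IsFiniteMeasure ν]
    {c : ℝ} (hc : 0 < c)
    (hμ : ∀ t < c, Integrable (fun x => Real.exp (t * x)) μ)
    (hν : ∀ t < c, Integrable (fun x => Real.exp (t * x)) ν)
    (h : ∀ t < c, ∫ x, Real.exp (t * x) ∂μ = ∫ x, Real.exp (t * x) ∂ν) : μ = ν := by
  have strip : ∀ {κ : Measure ℝ}, (∀ t < c, Integrable (fun x => Real.exp (t * x)) κ) →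
      AnalyticOnNhd ℂ (complexMGF id κ) {z | z.re < c} := by
    intro κ hκ
    refine analyticOnNhd_complexMGF.mono fun z (hz : z.re < c) => ?_
    exact mem_interior.2 ⟨Set.Iio c, fun t ht => hκ t ht, isOpen_Iio, hz⟩
  -- Identity theorem: both transforms are analytic on the half-plane and agree on reals near $0$.
  -- The imaginary axis, hence the characteristic function, lies in that half-plane because $c>0$.
  have heq : Set.EqOn (complexMGF id μ) (complexMGF id ν) {z | z.re < c} := by
    refine AnalyticOnNhd.eqOn_of_preconnected_of_frequently_eq (strip hμ) (strip hν)
      ((convex_Iio c).linear_preimage reLm).isPreconnected (z₀ := ((0 : ℝ) : ℂ))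
      (by simpa using hc) ?_
    have h_real : ∃ᶠ (x : ℝ) in 𝓝[≠] 0, complexMGF id μ x = complexMGF id ν x := by
      refine Eventually.frequently ?_
      filter_upwards [nhdsWithin_le_nhds (Iio_mem_nhds hc)] with x hx
      rw [complexMGF_ofReal, complexMGF_ofReal]
      exact congrArg _ (h x hx)
    rw [frequently_iff_seq_forall] at h_real ⊢
    obtain ⟨xs, hx_tendsto, hx_eq⟩ := h_real
    refine ⟨fun n ↦ xs n, ?_, fun n ↦ by simp [hx_eq]⟩
    rw [tendsto_nhdsWithin_iff] at hx_tendsto ⊢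
    refine ⟨?_, by simpa using hx_tendsto.2⟩
    rw [tendsto_ofReal_iff]
    exact hx_tendsto.1
  refine Measure.ext_of_charFun (funext fun t => ?_)
  rw [← complexMGF_id_mul_I, ← complexMGF_id_mul_I]
  exact heq (by simpa using hc)

/-- Finite values of the `lintegral` already give integrability, and $t=0$ gives finite mass, so
neither has to be checked separately for mixtures and images. -/
theorem measure_ext_of_lintegral_exp_eq {μ ν : Measure ℝ} {c : ℝ} (hc : 0 < c) {F : ℝ → ℝ}
    (hF : ∀ t < c, 0 ≤ F t)
    (hμ : ∀ t < c, ∫⁻ x, ENNReal.ofReal (Real.exp (t * x)) ∂μ = ENNReal.ofReal (F t))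
    (hν : ∀ t < c, ∫⁻ x, ENNReal.ofReal (Real.exp (t * x)) ∂ν = ENNReal.ofReal (F t)) : μ = ν := by
  have key : ∀ {κ : Measure ℝ},
      (∀ t < c, ∫⁻ x, ENNReal.ofReal (Real.exp (t * x)) ∂κ = ENNReal.ofReal (F t)) →
      IsFiniteMeasure κ ∧ (∀ t < c, Integrable (fun x => Real.exp (t * x)) κ) ∧
        ∀ t < c, ∫ x, Real.exp (t * x) ∂κ = F t := by
    intro κ hκ
    refine ⟨⟨?_⟩, fun t ht => ⟨by fun_prop, ?_⟩, fun t ht => ?_⟩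
    · have := hκ 0 hc
      simp only [zero_mul, Real.exp_zero, ENNReal.ofReal_one, lintegral_one] at this
      rw [this]
      exact ENNReal.ofReal_lt_top
    · rw [hasFiniteIntegral_iff_ofReal (ae_of_all _ fun x => (Real.exp_pos _).le), hκ t ht]
      exact ENNReal.ofReal_lt_top
    · rw [integral_eq_lintegral_of_nonneg_ae (ae_of_all _ fun x => (Real.exp_pos _).le)
        (by fun_prop), hκ t ht, ENNReal.toReal_ofReal (hF t ht)]
  obtain ⟨_, hi, he⟩ := key hμ
  obtain ⟨_, hi', he'⟩ := key hν
  exact measure_ext_of_mgf_eq_on_Iio hc hi hi' fun t ht => (he t ht).trans (he' t ht).symm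

/-! ### Central and noncentral chi-squared laws. -/

/-- The density at `t > 0` of the chi distribution with `2 w` degrees of freedom. -/
noncomputable def chiDensity (w t : ℝ) : ℝ :=
  t ^ (2 * w - 1) * Real.exp (-t ^ 2 / 2) / ((2 : ℝ) ^ (w - 1) * Real.Gamma w)

theorem measurable_chiDensity (w : ℝ) : Measurable (chiDensity w) := by
  unfold chiDensity
  fun_prop

theorem chiDensity_nonneg {w t : ℝ} (hw : 0 < w) (ht : 0 < t) : 0 ≤ chiDensity w t := by
  have := Real.Gamma_pos_of_pos hw
  unfold chiDensity
  positivity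

/-- The chi-squared distribution with `2 w` degrees of freedom, a point mass when `w = 0`. -/
noncomputable def chiSq (w : ℝ) : Measure ℝ :=
  if w = 0 then Measure.dirac 0
  else ((volume.restrict (Set.Ioi 0)).withDensity
    fun t => ENNReal.ofReal (chiDensity w t)).map (· ^ 2)

/-- The noncentral chi-squared distribution with `2 w` degrees of freedom and noncentrality
parameter `2 l`, as a Poisson mixture of central ones. -/
noncomputable def noncentralChiSq (w l : ℝ) : Measure ℝ :=
  Measure.sum fun j : ℕ =>
    ENNReal.ofReal (Real.exp (-l) * l ^ j / j.factorial) • chiSq (w + j)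

theorem exp_mul_chiDensity (w s t : ℝ) :
    Real.exp (s * t ^ 2) * chiDensity w t =
      t ^ (2 * w - 1) * Real.exp (-(1 / 2 - s) * t ^ (2 : ℝ)) *
        ((2 : ℝ) ^ (w - 1) * Real.Gamma w)⁻¹ := by
  have : Real.exp (-(1 / 2 - s) * t ^ (2 : ℝ)) = Real.exp (s * t ^ 2) * Real.exp (-t ^ 2 / 2) := by
    rw [← Real.exp_add, Real.rpow_two]
    congr 1
    ring
  rw [this, chiDensity, div_eq_mul_inv]
  ring

theorem integrableOn_exp_mul_chiDensity {w s : ℝ} (hw : 0 < w) (hs : s < 1 / 2) :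
    IntegrableOn (fun t => Real.exp (s * t ^ 2) * chiDensity w t) (Set.Ioi 0) := by
  simp only [exp_mul_chiDensity]
  exact (integrableOn_rpow_mul_exp_neg_mul_rpow (by linarith) (by norm_num)
    (by linarith)).mul_const _

theorem integral_exp_mul_chiDensity {w s : ℝ} (hw : 0 < w) (hs : s < 1 / 2) :
    ∫ t in Set.Ioi 0, Real.exp (s * t ^ 2) * chiDensity w t = (1 - 2 * s) ^ (-w) := by
  simp only [exp_mul_chiDensity]
  rw [integral_mul_const, integral_rpow_mul_exp_neg_mul_rpow (by norm_num) (by linarith)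
    (by linarith)]
  have hG := (Real.Gamma_pos_of_pos hw).ne'
  have e1 : -(2 * w - 1 + 1) / 2 = -w := by ring
  have e2 : (2 * w - 1 + 1) / 2 = w := by ring
  have e3 : (1 - 2 * s) = 2 * (1 / 2 - s) := by ring
  rw [e1, e2, e3, Real.mul_rpow two_pos.le (by linarith), Real.rpow_sub two_pos,
    Real.rpow_neg two_pos.le w, Real.rpow_one]
  have : (0 : ℝ) < 2 ^ w := by positivity
  generalize (1 / 2 - s) ^ (-w) = y
  field_simp

theorem lintegral_exp_chiSq {w s : ℝ} (hw : 0 ≤ w) (hs : s < 1 / 2) :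
    ∫⁻ x, ENNReal.ofReal (Real.exp (s * x)) ∂(chiSq w) = ENNReal.ofReal ((1 - 2 * s) ^ (-w)) := by
  rcases hw.eq_or_lt with rfl | hw
  · simp [chiSq]
  rw [chiSq, if_neg hw.ne', lintegral_map (by fun_prop) (by fun_prop),
    lintegral_withDensity_eq_lintegral_mul _ (measurable_chiDensity w).ennreal_ofReal (by fun_prop),
    ← integral_exp_mul_chiDensity hw hs, ofReal_integral_eq_lintegral_ofReal
      (integrableOn_exp_mul_chiDensity hw hs)]
  · refine setLIntegral_congr_fun measurableSet_Ioi fun t ht => ?_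
    simp only [Pi.mul_apply]
    rw [ENNReal.ofReal_mul (Real.exp_pos _).le, mul_comm]
  · filter_upwards [ae_restrict_mem measurableSet_Ioi] with t ht
    exact mul_nonneg (Real.exp_pos _).le (chiDensity_nonneg hw ht)

/-- Averaging $(1-2s)^{-(w+j)}$ over Poisson weights is an exponential series in $l/(1-2s)$. -/
theorem lintegral_exp_noncentralChiSq {w l s : ℝ} (hw : 0 ≤ w) (hl : 0 ≤ l) (hs : s < 1 / 2) :
    ∫⁻ x, ENNReal.ofReal (Real.exp (s * x)) ∂(noncentralChiSq w l) =
      ENNReal.ofReal ((1 - 2 * s) ^ (-w) * Real.exp (2 * l * s / (1 - 2 * s))) := by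
  have h1 : (0 : ℝ) < 1 - 2 * s := by linarith
  have hsum : HasSum (fun j : ℕ => (1 - 2 * s) ^ (-w) * Real.exp (-l) *
      ((l / (1 - 2 * s)) ^ j / j.factorial))
      ((1 - 2 * s) ^ (-w) * Real.exp (-l) * Real.exp (l / (1 - 2 * s))) := by
    refine HasSum.mul_left _ ?_
    rw [Real.exp_eq_exp_ℝ]
    exact NormedSpace.expSeries_div_hasSum_exp _
  have hval : (1 - 2 * s) ^ (-w) * Real.exp (2 * l * s / (1 - 2 * s)) =
      (1 - 2 * s) ^ (-w) * Real.exp (-l) * Real.exp (l / (1 - 2 * s)) := by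
    rw [mul_assoc ((1 - 2 * s) ^ (-w)), ← Real.exp_add]
    congr 2
    field_simp
    ring
  rw [noncentralChiSq, lintegral_sum_measure, hval, ← hsum.tsum_eq,
    ENNReal.ofReal_tsum_of_nonneg (fun j => by positivity) hsum.summable]
  refine tsum_congr fun j => ?_
  rw [lintegral_smul_measure, lintegral_exp_chiSq (by positivity) hs, smul_eq_mul,
    ← ENNReal.ofReal_mul (by positivity), neg_add, Real.rpow_add h1, Real.rpow_neg h1.le (j : ℝ),
    Real.rpow_natCast, div_pow]
  congr 1
  field_simp

/-- The transforms multiply. Zero degrees of freedom in the second factor let it carry the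
additional noncentrality alone. -/
theorem noncentralChiSq_conv {w l d : ℝ} (hw : 0 ≤ w) (hl : 0 ≤ l) (hd : 0 ≤ d)
    [SFinite (noncentralChiSq w l)] [SFinite (noncentralChiSq 0 d)] :
    ((noncentralChiSq w l).prod (noncentralChiSq 0 d)).map (fun p => p.1 + p.2) =
      noncentralChiSq w (l + d) := by
  refine measure_ext_of_lintegral_exp_eq (c := 1 / 2) (by norm_num)
    (F := fun s => (1 - 2 * s) ^ (-w) * Real.exp (2 * (l + d) * s / (1 - 2 * s)))
    (fun s hs => ?_) (fun s hs => ?_) (fun s hs => lintegral_exp_noncentralChiSq hw (by positivity) hs)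
  · have h1 : (0 : ℝ) < 1 - 2 * s := by linarith
    positivity
  have h1 : (0 : ℝ) < 1 - 2 * s := by linarith
  rw [lintegral_map (by fun_prop) (by fun_prop)]
  have hexp : ∀ p : ℝ × ℝ, ENNReal.ofReal (Real.exp (s * (p.1 + p.2))) =
      ENNReal.ofReal (Real.exp (s * p.1)) * ENNReal.ofReal (Real.exp (s * p.2)) := fun p => by
    rw [mul_add, Real.exp_add, ENNReal.ofReal_mul (Real.exp_pos _).le]
  simp only [hexp]
  rw [lintegral_prod_mul (f := fun x => ENNReal.ofReal (Real.exp (s * x)))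
    (g := fun x => ENNReal.ofReal (Real.exp (s * x))) (by fun_prop) (by fun_prop),
    lintegral_exp_noncentralChiSq hw hl hs,
    lintegral_exp_noncentralChiSq le_rfl hd hs, ← ENNReal.ofReal_mul (by positivity)]
  congr 1
  rw [neg_zero, Real.rpow_zero, one_mul, mul_assoc, ← Real.exp_add, mul_add, add_mul, add_div]

theorem isProbabilityMeasure_noncentralChiSq {w l : ℝ} (hw : 0 ≤ w) (hl : 0 ≤ l) :
    IsProbabilityMeasure (noncentralChiSq w l) := by
  constructor
  simpa using lintegral_exp_noncentralChiSq hw hl (s := 0) (by norm_num)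

theorem chiSq_Iio_zero (w : ℝ) : chiSq w (Set.Iio 0) = 0 := by
  unfold chiSq
  split_ifs
  · simp
  · rw [Measure.map_apply (by fun_prop) measurableSet_Iio]
    have : (fun t : ℝ => t ^ 2) ⁻¹' Set.Iio 0 = ∅ := by
      ext t
      simpa using sq_nonneg t
    rw [this, measure_empty]

theorem noncentralChiSq_Iio_zero (w l : ℝ) : noncentralChiSq w l (Set.Iio 0) = 0 := by
  rw [noncentralChiSq, Measure.sum_apply _ measurableSet_Iio]
  simp [chiSq_Iio_zero]

/-- The noncentral chi-squared distributions increase stochastically with the noncentrality. -/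
theorem noncentralChiSq_Ioi_mono {w l l' : ℝ} (hw : 0 ≤ w) (hl : 0 ≤ l) (hll' : l ≤ l') (c : ℝ) :
    (noncentralChiSq w l).real (Set.Ioi c) ≤ (noncentralChiSq w l').real (Set.Ioi c) := by
  obtain ⟨d, rfl⟩ := exists_add_of_le hll'
  have hd : 0 ≤ d := by linarith
  have := isProbabilityMeasure_noncentralChiSq hw hl
  have := isProbabilityMeasure_noncentralChiSq le_rfl hd
  have := isProbabilityMeasure_noncentralChiSq hw (add_nonneg hl hd)
  refine ENNReal.toReal_mono (measure_ne_top _ _) ?_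
  -- The additional noncentrality is an independent summand that is almost surely nonnegative, so
  -- adding it can only enlarge the tail.
  have hpos : noncentralChiSq 0 d (Set.Ici 0) = 1 := by
    rw [← Set.compl_Iio, prob_compl_eq_one_iff measurableSet_Iio, noncentralChiSq_Iio_zero]
  rw [← noncentralChiSq_conv hw hl hd, Measure.map_apply (by fun_prop) measurableSet_Ioi,
    ← mul_one (noncentralChiSq w l (Set.Ioi c)), ← hpos, ← Measure.prod_prod]
  refine measure_mono ?_
  rintro ⟨x, y⟩ ⟨hx, hy⟩
  simp only [Set.mem_Ioi, Set.mem_Ici, Set.mem_preimage] at *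
  linarith

/-! ### Tails and the Marcum function. -/

theorem chiSq_Ioi_sq {w b : ℝ} (hw : 0 < w) (hb : 0 ≤ b) :
    (chiSq w).real (Set.Ioi (b ^ 2)) = ∫ t in Set.Ioi b, chiDensity w t := by
  have hset : Set.Ioi 0 ∩ (fun t : ℝ => t ^ 2) ⁻¹' Set.Ioi (b ^ 2) = Set.Ioi b := by
    ext t
    simp only [Set.mem_inter_iff, Set.mem_Ioi, Set.mem_preimage]
    exact ⟨fun h => lt_of_pow_lt_pow_left₀ 2 h.1.le h.2,
      fun h => ⟨hb.trans_lt h, by gcongr⟩⟩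
  have hmeas : MeasurableSet ((fun t : ℝ => t ^ 2) ⁻¹' Set.Ioi (b ^ 2)) :=
    (measurable_id.pow_const 2) measurableSet_Ioi
  rw [measureReal_def, chiSq, if_neg hw.ne', Measure.map_apply (by fun_prop) measurableSet_Ioi,
    withDensity_apply _ hmeas, Measure.restrict_restrict hmeas, Set.inter_comm, hset,
    integral_eq_lintegral_of_nonneg_ae _ (measurable_chiDensity w).aestronglyMeasurable]
  filter_upwards [ae_restrict_mem measurableSet_Ioi] with t ht
  exact chiDensity_nonneg hw (hb.trans_lt ht)

theorem integrableOn_chiDensity {w b : ℝ} (hw : 0 < w) (hb : 0 ≤ b) :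
    IntegrableOn (chiDensity w) (Set.Ioi b) := by
  have := integrableOn_exp_mul_chiDensity hw (s := 0) (by norm_num)
  simp only [zero_mul, Real.exp_zero, one_mul] at this
  exact this.mono_set (Set.Ioi_subset_Ioi hb)

theorem integral_chiDensity_le_one {w b : ℝ} (hw : 0 < w) (hb : 0 ≤ b) :
    ∫ t in Set.Ioi b, chiDensity w t ≤ 1 := by
  have h := integral_exp_mul_chiDensity hw (s := 0) (by norm_num)
  simp only [zero_mul, Real.exp_zero, one_mul, mul_zero, sub_zero, Real.one_rpow] at h
  rw [← h]
  refine setIntegral_mono_set (integrableOn_chiDensity hw le_rfl) ?_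
    (Set.Ioi_subset_Ioi hb).eventuallyLE
  filter_upwards [ae_restrict_mem measurableSet_Ioi] with t ht using chiDensity_nonneg hw ht

theorem summable_poisson_weight (l : ℝ) :
    Summable fun j : ℕ => Real.exp (-l) * l ^ j / (j.factorial : ℝ) := by
  simp only [mul_div_assoc]
  exact (Real.summable_pow_div_factorial l).mul_left _

theorem noncentralChiSq_Ioi_sq {w l b : ℝ} (hw : 0 < w) (hl : 0 ≤ l) (hb : 0 ≤ b) :
    (noncentralChiSq w l).real (Set.Ioi (b ^ 2)) =
      ∑' j : ℕ, Real.exp (-l) * l ^ j / j.factorial *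
        ∫ t in Set.Ioi b, chiDensity (w + j) t := by
  rw [measureReal_def, noncentralChiSq, Measure.sum_apply _ measurableSet_Ioi,
    ENNReal.tsum_toReal_eq]
  · refine tsum_congr fun j => ?_
    rw [Measure.smul_apply, smul_eq_mul, ENNReal.toReal_mul,
      ENNReal.toReal_ofReal (by positivity), ← chiSq_Ioi_sq (by positivity) hb, measureReal_def]
  · intro j
    rw [Measure.smul_apply, smul_eq_mul]
    refine ENNReal.mul_ne_top ENNReal.ofReal_ne_top (ne_top_of_le_ne_top (b := 1) (by simp) ?_)
    have h := lintegral_exp_chiSq (w := w + j) (s := 0) (by positivity) (by norm_num)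
    simp only [zero_mul, Real.exp_zero, ENNReal.ofReal_one, lintegral_one, mul_zero, sub_zero,
      Real.one_rpow] at h
    exact h ▸ measure_mono (Set.subset_univ _)

/-- In the Bessel series $a^{1-v}$ cancels the fractional power of $a$. What remains of $a$ forms
Poisson weights of rate $a^2/2$, and the powers of $t$ form chi densities. -/
theorem marcum_integrand_eq_tsum {v a t : ℝ} (ha : 0 < a) (ht : 0 < t) :
    a ^ (1 - v) * (t ^ v * Real.exp (-(t ^ 2 + a ^ 2) / 2) * besselI (v - 1) (a * t)) =
      ∑' j : ℕ, Real.exp (-(a ^ 2 / 2)) * (a ^ 2 / 2) ^ j / j.factorial *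
        chiDensity (v + j) t := by
  rw [besselI, ← tsum_mul_left, ← tsum_mul_left]
  refine tsum_congr fun j => ?_
  have hexp : Real.exp (-(t ^ 2 + a ^ 2) / 2) =
      Real.exp (-(a ^ 2 / 2)) * Real.exp (-t ^ 2 / 2) := by
    rw [← Real.exp_add]
    congr 1
    ring
  have hx : (a * t / 2) ^ (2 * (j : ℝ) + (v - 1)) =
      a ^ (2 * j) * (a ^ (1 - v))⁻¹ * (t ^ (2 * (v + j) - 1) * (t ^ v)⁻¹) *
        ((2 : ℝ) ^ j * 2 ^ (v + j - 1))⁻¹ := by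
    rw [Real.div_rpow (by positivity) two_pos.le, Real.mul_rpow ha.le ht.le, div_eq_mul_inv,
      ← Real.rpow_natCast a, ← Real.rpow_natCast 2 j, ← Real.rpow_neg ha.le,
      ← Real.rpow_neg ht.le, ← Real.rpow_add ha, ← Real.rpow_add ht, ← Real.rpow_add two_pos]
    push_cast
    congr 3 <;> ring_nf
  have hG : Real.Gamma (j + (v - 1) + 1) = Real.Gamma (v + j) := by
    congr 1
    ring
  have h1 : a ^ (1 - v) ≠ 0 := (Real.rpow_pos_of_pos ha _).ne'
  have h2 : t ^ v ≠ 0 := (Real.rpow_pos_of_pos ht _).ne'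
  rw [hexp, hx, hG, chiDensity, div_pow, ← pow_mul]
  generalize a ^ (1 - v) = p at *
  generalize t ^ v = q at *
  generalize t ^ (2 * (v + j) - 1) = r at *
  simp only [div_eq_mul_inv, mul_inv]
  generalize Real.exp (-(a ^ 2 * 2⁻¹)) = A
  calc _ = (p * p⁻¹) * (q * q⁻¹) * (A * (a ^ (2 * j) * ((2 : ℝ) ^ j)⁻¹) *
        ((j.factorial : ℝ))⁻¹ * (r * Real.exp (-t ^ 2 * 2⁻¹) *
          (((2 : ℝ) ^ (v + j - 1))⁻¹ * (Real.Gamma (v + j))⁻¹))) := by ring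
    _ = _ := by rw [mul_inv_cancel₀ h1, mul_inv_cancel₀ h2, one_mul, one_mul]

/-- The generalized Marcum `Q`-function is the tail of a noncentral chi-squared distribution. -/
theorem marcumQ_eq_noncentralChiSq {v a b : ℝ} (hv : 0 < v) (ha : 0 ≤ a) (hb : 0 ≤ b) :
    marcumQ v a b = (noncentralChiSq v (a ^ 2 / 2)).real (Set.Ioi (b ^ 2)) := by
  rw [noncentralChiSq_Ioi_sq hv (by positivity) hb]
  rcases ha.eq_or_lt with rfl | ha
  -- At rate $0$ the Poisson law is concentrated at $j=0$, as $0^0=1$.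
  · rw [marcumQ, if_pos rfl, tsum_eq_single 0]
    · simp only [chiDensity, div_eq_mul_inv, integral_mul_const]
      simp [mul_comm]
    · intro j hj
      simp [hj]
  rw [marcumQ, if_neg ha.ne', ← integral_const_mul]
  have hint : ∀ j : ℕ, IntegrableOn (fun t => Real.exp (-(a ^ 2 / 2)) * (a ^ 2 / 2) ^ j /
      j.factorial * chiDensity (v + j) t) (Set.Ioi b) := fun j =>
    (integrableOn_chiDensity (by positivity) hb).const_mul _
  -- Sum and integral may be exchanged: each chi tail is at most $1$, so the Poisson weights
  -- dominate.
  have hsum : Summable fun j : ℕ => ∫ t in Set.Ioi b, ‖Real.exp (-(a ^ 2 / 2)) *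
      (a ^ 2 / 2) ^ j / j.factorial * chiDensity (v + j) t‖ := by
    refine Summable.of_nonneg_of_le (fun j => integral_nonneg fun t => norm_nonneg _) (fun j => ?_)
      (summable_poisson_weight (a ^ 2 / 2))
    have : ∫ t in Set.Ioi b, ‖Real.exp (-(a ^ 2 / 2)) *
        (a ^ 2 / 2) ^ j / j.factorial * chiDensity (v + j) t‖ = Real.exp (-(a ^ 2 / 2)) *
        (a ^ 2 / 2) ^ j / j.factorial * ∫ t in Set.Ioi b, chiDensity (v + j) t := by
      rw [← integral_const_mul]
      refine setIntegral_congr_fun measurableSet_Ioi fun t ht => ?_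
      exact Real.norm_of_nonneg (mul_nonneg (by positivity)
        (chiDensity_nonneg (by positivity) (hb.trans_lt ht)))
    rw [this]
    exact mul_le_of_le_one_right (by positivity) (integral_chiDensity_le_one (by positivity) hb)
  have key := (hasSum_integral_of_summable_integral_norm hint hsum).tsum_eq
  simp only [integral_const_mul] at key
  rw [key]
  exact setIntegral_congr_fun measurableSet_Ioi fun t ht =>
    marcum_integrand_eq_tsum ha (hb.trans_lt ht)

/-! ### Exponential moments of Gaussian squares. -/

theorem lintegral_exp_sq_gaussianReal {s : ℝ} (hs : s < 1 / 2) (m : ℝ) :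
    ∫⁻ x, ENNReal.ofReal (Real.exp (s * (m + x) ^ 2)) ∂(gaussianReal 0 1) =
      ENNReal.ofReal ((1 - 2 * s) ^ (-(1 / 2) : ℝ) * Real.exp (s * m ^ 2 / (1 - 2 * s))) := by
  have h1 : (0 : ℝ) < 1 - 2 * s := by linarith
  set r : ℝ := 1 - 2 * s with hr
  have hs' : s = (1 - r) / 2 := by linarith
  have hv : (r⁻¹.toNNReal : ℝ) = r⁻¹ := Real.coe_toNNReal _ (by positivity)
  have hv0 : r⁻¹.toNNReal ≠ 0 := by
    rw [Ne, Real.toNNReal_eq_zero]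
    push Not
    positivity
  have hsqrt : r ^ (-(1 / 2) : ℝ) = (√r)⁻¹ := by
    rw [Real.rpow_neg h1.le, Real.sqrt_eq_rpow]
  -- Completing the square leaves a Gaussian density of mean $2sm/r$ and variance $1/r$, which
  -- integrates to $1$.
  have hpt : ∀ x, gaussianPDF 0 1 x * ENNReal.ofReal (Real.exp (s * (m + x) ^ 2)) =
      ENNReal.ofReal (r ^ (-(1 / 2) : ℝ) * Real.exp (s * m ^ 2 / r)) *
        gaussianPDF (2 * s * m / r) r⁻¹.toNNReal x := by
    intro x
    rw [gaussianPDF, gaussianPDF, ← ENNReal.ofReal_mul (gaussianPDFReal_nonneg _ _ _),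
      ← ENNReal.ofReal_mul (by positivity), hsqrt, gaussianPDFReal, gaussianPDFReal, hv]
    congr 1
    have e : Real.exp (-(x - 0) ^ 2 / (2 * ((1 : NNReal) : ℝ))) * Real.exp (s * (m + x) ^ 2) =
        Real.exp (s * m ^ 2 / r) * Real.exp (-(x - 2 * s * m / r) ^ 2 / (2 * r⁻¹)) := by
      rw [← Real.exp_add, ← Real.exp_add]
      congr 1
      simp only [NNReal.coe_one]
      rw [hs']
      field_simp
      ring
    have hq : √(2 * Real.pi * r⁻¹) = √(2 * Real.pi) * (√r)⁻¹ := by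
      rw [Real.sqrt_mul (by positivity), Real.sqrt_inv]
    have hr0 : √r ≠ 0 := (Real.sqrt_pos.2 h1).ne'
    rw [mul_assoc, e, hq, mul_inv, inv_inv, NNReal.coe_one, mul_one]
    field_simp
  rw [gaussianReal_of_var_ne_zero _ one_ne_zero,
    lintegral_withDensity_eq_lintegral_mul _ (measurable_gaussianPDF _ _) (by fun_prop)]
  simp only [Pi.mul_apply, hpt]
  rw [lintegral_const_mul _ (measurable_gaussianPDF _ _), lintegral_gaussianPDF_eq_one _ hv0,
    mul_one]

theorem lintegral_prod_pi {ι : Type*} [Fintype ι] (μ : ι → Measure ℝ)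
    [∀ i, IsProbabilityMeasure (μ i)] {f : ι → ℝ → ENNReal} (hf : ∀ i, Measurable (f i)) :
    ∫⁻ x, ∏ i, f i (x i) ∂(Measure.pi μ) = ∏ i, ∫⁻ x, f i x ∂(μ i) := by
  rw [lintegral_prod_eq_prod_lintegral_of_indepFun _ (fun i (x : ι → ℝ) => f i (x i))
    (iIndepFun_pi fun i => (hf i).aemeasurable) fun i => (hf i).comp (measurable_pi_apply i)]
  exact Finset.prod_congr rfl fun i _ =>
    (measurePreserving_eval μ i).lintegral_comp (hf i)

open scoped RealInnerProductSpace

/-! ### Orthogonal projections of Gaussian vectors. -/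

section Projection

variable {ι : Type*} [Fintype ι] [DecidableEq ι] {Q : Matrix ι ι ℝ}

theorem eigenvalues_eq_zero_or_one (hQ : Q.IsHermitian) (hQQ : Q * Q = Q) (i : ι) :
    hQ.eigenvalues i = 0 ∨ hQ.eigenvalues i = 1 := by
  have h := hQ.mulVec_eigenvectorBasis i
  have h2 : Q.mulVec (Q.mulVec (hQ.eigenvectorBasis i).ofLp) =
      Q.mulVec (hQ.eigenvectorBasis i).ofLp := by
    rw [Matrix.mulVec_mulVec, hQQ]
  rw [h, Matrix.mulVec_smul, h, smul_smul] at h2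
  have hne : (hQ.eigenvectorBasis i).ofLp ≠ 0 := fun h0 =>
    hQ.eigenvectorBasis.toBasis.ne_zero i (by
      rw [OrthonormalBasis.coe_toBasis]
      exact (WithLp.ofLp_eq_zero 2).1 h0)
  have h3 := smul_left_injective ℝ hne h2
  have : hQ.eigenvalues i * (hQ.eigenvalues i - 1) = 0 := by
    rw [mul_sub, mul_one]
    exact sub_eq_zero.2 h3
  rcases mul_eq_zero.1 this with h | h
  · exact Or.inl h
  · exact Or.inr (sub_eq_zero.1 h)

theorem norm_sq_projection (hQ : Q.IsHermitian) (hQQ : Q * Q = Q) (y : EuclideanSpace ℝ ι) :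
    ‖Q.toEuclideanLin y‖ ^ 2 =
      ∑ i, hQ.eigenvalues i * ⟪hQ.eigenvectorBasis i, y⟫ ^ 2 := by
  rw [← hQ.eigenvectorBasis.sum_sq_inner_right]
  refine Finset.sum_congr rfl fun i _ => ?_
  have hb : Q.toEuclideanLin (hQ.eigenvectorBasis i) =
      hQ.eigenvalues i • hQ.eigenvectorBasis i := by
    rw [Matrix.toLpLin_apply, hQ.mulVec_eigenvectorBasis]
    rfl
  rw [← Matrix.isSymmetric_toEuclideanLin_iff.2 hQ, hb, real_inner_smul_left]
  rcases eigenvalues_eq_zero_or_one hQ hQQ i with h | h <;> simp [h]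

/-- A projected Gaussian vector has noncentral chi-squared squared norm. -/
theorem map_norm_sq_projection_stdGaussian (hQ : Q.IsHermitian) (hQQ : Q * Q = Q)
    (m : EuclideanSpace ℝ ι) :
    (stdGaussian (EuclideanSpace ℝ ι)).map (fun x => ‖Q.toEuclideanLin (m + x)‖ ^ 2) =
      noncentralChiSq (Q.trace / 2) (‖Q.toEuclideanLin m‖ ^ 2 / 2) := by
  have htr : Q.trace = ∑ i, hQ.eigenvalues i := by simpa using hQ.trace_eq_sum_eigenvalues
  have htr0 : 0 ≤ Q.trace := by
    rw [htr]
    refine Finset.sum_nonneg fun i _ => ?_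
    rcases eigenvalues_eq_zero_or_one hQ hQQ i with h | h <;> simp [h]
  have hcont : Continuous fun x => ‖Q.toEuclideanLin (m + x)‖ ^ 2 := by
    have := Q.toEuclideanLin.continuous_of_finiteDimensional
    fun_prop
  have hbas : Measurable fun x : ι → ℝ => ∑ i, x i • hQ.eigenvectorBasis i := by fun_prop
  refine measure_ext_of_lintegral_exp_eq (c := 1 / 2) (by norm_num) (fun s hs => ?_)
    (fun s hs => ?_) (fun s hs => lintegral_exp_noncentralChiSq (by positivity) (by positivity) hs)
  · have h1 : (0 : ℝ) < 1 - 2 * s := by linarith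
    positivity
  have h1 : (0 : ℝ) < 1 - 2 * s := by linarith
  rw [lintegral_map (by fun_prop) hcont.measurable,
    stdGaussian_eq_map_pi_orthonormalBasis hQ.eigenvectorBasis,
    lintegral_map (Measurable.ennreal_ofReal (by fun_prop)) hbas]
  have hcoord : ∀ (x : ι → ℝ) (i : ι),
      ⟪hQ.eigenvectorBasis i, m + ∑ j, x j • hQ.eigenvectorBasis j⟫ =
        ⟪hQ.eigenvectorBasis i, m⟫ + x i := by
    intro x i
    rw [inner_add_right, hQ.eigenvectorBasis.orthonormal.inner_right_fintype]
  have hfac : ∀ x : ι → ℝ, ENNReal.ofReal (Real.exp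
      (s * ‖Q.toEuclideanLin (m + ∑ j, x j • hQ.eigenvectorBasis j)‖ ^ 2)) =
      ∏ i, ENNReal.ofReal (Real.exp
        (s * hQ.eigenvalues i * (⟪hQ.eigenvectorBasis i, m⟫ + x i) ^ 2)) := by
    intro x
    rw [norm_sq_projection hQ hQQ, Finset.mul_sum, Real.exp_sum,
      ENNReal.ofReal_prod_of_nonneg fun i _ => (Real.exp_pos _).le]
    simp only [hcoord, mul_assoc]
  -- An eigenvalue $0$ contributes the factor $1$, an eigenvalue $1$ a shifted Gaussian square.
  -- Writing the eigenvalue into the exponents covers both, and their sum becomes the trace.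
  have hone : ∀ i, ∫⁻ x, ENNReal.ofReal (Real.exp
      (s * hQ.eigenvalues i * (⟪hQ.eigenvectorBasis i, m⟫ + x) ^ 2)) ∂(gaussianReal 0 1) =
      ENNReal.ofReal ((1 - 2 * s) ^ (-(hQ.eigenvalues i / 2)) *
        Real.exp (s / (1 - 2 * s) * (hQ.eigenvalues i * ⟪hQ.eigenvectorBasis i, m⟫ ^ 2))) := by
    intro i
    rcases eigenvalues_eq_zero_or_one hQ hQQ i with h | h
    · simp [h]
    · simp only [h, mul_one, lintegral_exp_sq_gaussianReal hs]
      congr 3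
      ring
  simp only [hfac]
  rw [lintegral_prod_pi (fun _ => gaussianReal 0 1)
    (f := fun i x => ENNReal.ofReal (Real.exp
        (s * hQ.eigenvalues i * (⟪hQ.eigenvectorBasis i, m⟫ + x) ^ 2))) (fun i => by fun_prop)]
  simp only [hone]
  rw [← ENNReal.ofReal_prod_of_nonneg fun i _ => by positivity, Finset.prod_mul_distrib,
    ← Real.rpow_sum_of_pos h1, ← Real.exp_sum, ← Finset.mul_sum, ← norm_sq_projection hQ hQQ,
    Finset.sum_neg_distrib, ← Finset.sum_div, ← htr]
  congr 3
  ring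

theorem norm_projection_le (hQ : Q.IsHermitian) (hQQ : Q * Q = Q) (y : EuclideanSpace ℝ ι) :
    ‖Q.toEuclideanLin y‖ ^ 2 ≤ ‖y‖ ^ 2 := by
  rw [norm_sq_projection hQ hQQ, ← hQ.eigenvectorBasis.sum_sq_inner_right]
  refine Finset.sum_le_sum fun i _ => mul_le_of_le_one_left (sq_nonneg _) ?_
  rcases eigenvalues_eq_zero_or_one hQ hQQ i with h | h <;> simp [h]

open scoped MatrixOrder in
theorem multivariateGaussian_zero_smul_one {σ : ℝ} (hσ : 0 ≤ σ) :
    multivariateGaussian 0 (σ ^ 2 • (1 : Matrix ι ι ℝ)) =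
      (stdGaussian (EuclideanSpace ℝ ι)).map (fun x => σ • x) := by
  have hsqrt : CFC.sqrt (σ ^ 2 • (1 : Matrix ι ι ℝ)) = σ • 1 := by
    refine CFC.sqrt_unique (by simp [smul_smul, pow_two]) ?_
    exact (Matrix.PosSemidef.one.smul hσ).nonneg
  rw [multivariateGaussian, hsqrt]
  congr 1
  ext1 x
  simp

end Projection

/-! ### The attack projection, the likelihood ratio and the false-alarm law. -/

section AttackProjection

variable {M V : Type*} [DecidableEq V]
  {H : Matrix M V ℝ} {L : Finset M} {Λ : Finset V}

open Matrix

theorem isUnit_det_gram (hrank : LinearIndependent ℝ (attackMatrix H L Λ).col) :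
    IsUnit ((attackMatrix H L Λ)ᵀ * attackMatrix H L Λ).det := by
  have h := PosDef.conjTranspose_mul_self (attackMatrix H L Λ) (mulVec_injective_iff.2 hrank)
  rw [conjTranspose_eq_transpose_of_trivial] at h
  exact (isUnit_iff_isUnit_det _).1 h.isUnit

theorem attackProj_isHermitian (H : Matrix M V ℝ) (L : Finset M) (Λ : Finset V) :
    (attackProj H L Λ).IsHermitian := by
  rw [IsHermitian, conjTranspose_eq_transpose_of_trivial, attackProj]
  simp [transpose_mul, transpose_nonsing_inv, Matrix.mul_assoc]

theorem attackProj_mul_attackMatrix (hrank : LinearIndependent ℝ (attackMatrix H L Λ).col) :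
    attackProj H L Λ * attackMatrix H L Λ = attackMatrix H L Λ := by
  rw [attackProj, Matrix.mul_assoc, Matrix.mul_assoc, nonsing_inv_mul _ (isUnit_det_gram hrank),
    Matrix.mul_one]

theorem attackProj_mul_self (hrank : LinearIndependent ℝ (attackMatrix H L Λ).col) :
    attackProj H L Λ * attackProj H L Λ = attackProj H L Λ := by
  nth_rewrite 2 [attackProj]
  rw [← Matrix.mul_assoc, ← Matrix.mul_assoc, attackProj_mul_attackMatrix hrank, attackProj]

theorem trace_attackProj (hrank : LinearIndependent ℝ (attackMatrix H L Λ).col) :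
    (attackProj H L Λ).trace = Λ.card := by
  rw [attackProj, trace_mul_comm, ← Matrix.mul_assoc, mul_nonsing_inv _ (isUnit_det_gram hrank),
    trace_one, Fintype.card_coe]

theorem toEuclideanLin_toEuclideanLin {l m n : Type*} [Fintype l] [Fintype m] [Fintype n]
    [DecidableEq m] [DecidableEq n]
    (A : Matrix l m ℝ) (B : Matrix m n ℝ) (x : EuclideanSpace ℝ n) :
    A.toEuclideanLin (B.toEuclideanLin x) = (A * B).toEuclideanLin x := by
  simp [toLpLin_apply]

/-- Minimizing the residual over the attack leaves the component orthogonal to the attack space. -/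
theorem norm_sub_attack_sq [DecidableEq M] (hrank : LinearIndependent ℝ (attackMatrix H L Λ).col)
    (y : EuclideanSpace ℝ L) (c : EuclideanSpace ℝ Λ) :
    ‖y - (attackMatrix H L Λ).toEuclideanLin c‖ ^ 2 =
      ‖y‖ ^ 2 - ‖(attackProj H L Λ).toEuclideanLin y‖ ^ 2 +
        ‖(attackProj H L Λ).toEuclideanLin y - (attackMatrix H L Λ).toEuclideanLin c‖ ^ 2 := by
  have hsym := isSymmetric_toEuclideanLin_iff.2 (attackProj_isHermitian H L Λ)
  have h1 : ⟪(attackProj H L Λ).toEuclideanLin y, (attackMatrix H L Λ).toEuclideanLin c⟫ =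
      ⟪y, (attackMatrix H L Λ).toEuclideanLin c⟫ := by
    rw [hsym, toEuclideanLin_toEuclideanLin, attackProj_mul_attackMatrix hrank]
  rw [norm_sub_sq_real, norm_sub_sq_real, h1]
  ring

/-- The likelihood is the right side times a factor at most $1$, which equals $1$ at the
least-squares attack. -/
theorem iSup_gaussianLikelihood [DecidableEq M]
    (hrank : LinearIndependent ℝ (attackMatrix H L Λ).col)
    {σ : ℝ} (hσ : 0 < σ) (m z : EuclideanSpace ℝ L) :
    ⨆ c : EuclideanSpace ℝ Λ,
        gaussianLikelihood σ ((attackMatrix H L Λ).toEuclideanLin c + m) z =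
      gaussianLikelihood σ m z *
        Real.exp (‖(attackProj H L Λ).toEuclideanLin (z - m)‖ ^ 2 / (2 * σ ^ 2)) := by
  have hval : ∀ c, gaussianLikelihood σ ((attackMatrix H L Λ).toEuclideanLin c + m) z =
      gaussianLikelihood σ m z *
        Real.exp (‖(attackProj H L Λ).toEuclideanLin (z - m)‖ ^ 2 / (2 * σ ^ 2)) *
        Real.exp (-‖(attackProj H L Λ).toEuclideanLin (z - m) -
          (attackMatrix H L Λ).toEuclideanLin c‖ ^ 2 / (2 * σ ^ 2)) := by
    intro c
    have hz : z - ((attackMatrix H L Λ).toEuclideanLin c + m) =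
        z - m - (attackMatrix H L Λ).toEuclideanLin c := by abel
    rw [gaussianLikelihood, gaussianLikelihood, hz, norm_sub_attack_sq hrank]
    simp only [mul_assoc, ← Real.exp_add]
    congr 2
    ring
  have hC : 0 ≤ gaussianLikelihood σ m z *
      Real.exp (‖(attackProj H L Λ).toEuclideanLin (z - m)‖ ^ 2 / (2 * σ ^ 2)) := by
    unfold gaussianLikelihood
    positivity
  have hle : ∀ c, gaussianLikelihood σ ((attackMatrix H L Λ).toEuclideanLin c + m) z ≤
      gaussianLikelihood σ m z *
        Real.exp (‖(attackProj H L Λ).toEuclideanLin (z - m)‖ ^ 2 / (2 * σ ^ 2)) := by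
    intro c
    rw [hval]
    refine mul_le_of_le_one_right hC (Real.exp_le_one_iff.2 ?_)
    rw [neg_div]
    exact neg_nonpos.2 (by positivity)
  refine le_antisymm (ciSup_le hle) ?_
  obtain ⟨c, hc⟩ : ∃ c : EuclideanSpace ℝ Λ, (attackMatrix H L Λ).toEuclideanLin c =
      (attackProj H L Λ).toEuclideanLin (z - m) :=
    ⟨(((attackMatrix H L Λ)ᵀ * attackMatrix H L Λ)⁻¹ *
      (attackMatrix H L Λ)ᵀ).toEuclideanLin (z - m), by
      rw [toEuclideanLin_toEuclideanLin, attackProj, Matrix.mul_assoc]⟩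
  refine le_of_eq_of_le ?_ (le_ciSup ⟨_, Set.forall_mem_range.2 hle⟩ c)
  rw [hval, hc, sub_self, norm_zero]
  simp

theorem logGLR_eq_glrtStat [DecidableEq M] [Fintype V]
    (hrank : LinearIndependent ℝ (attackMatrix H L Λ).col)
    {σ : ℝ} (hσ : 0 < σ) {x : EuclideanSpace ℝ V}
    (hx : (attackProj H L Λ).toEuclideanLin ((loadMatrix H L).toEuclideanLin x) = 0)
    (z : EuclideanSpace ℝ L) : logGLR H L Λ σ x z = glrtStat H L Λ σ z := by
  have hpos : 0 < gaussianLikelihood σ ((loadMatrix H L).toEuclideanLin x) z := by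
    unfold gaussianLikelihood
    positivity
  rw [logGLR, iSup_gaussianLikelihood hrank hσ, mul_div_cancel_left₀ _ hpos.ne', Real.log_exp,
    map_sub, hx, sub_zero, glrtStat]
  field_simp

theorem falseAlarmProb_eq_noncentralChiSq [DecidableEq M] [Fintype V]
    {Ω : Type*} [MeasurableSpace Ω] {P : Measure Ω}
    (hrank : LinearIndependent ℝ (attackMatrix H L Λ).col) {σ γ : ℝ} (hσ : 0 < σ)
    {e : Ω → EuclideanSpace ℝ L}
    (he : HasLaw e (multivariateGaussian 0 (σ ^ 2 • (1 : Matrix L L ℝ))) P)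
    (Δθ : EuclideanSpace ℝ V) :
    falseAlarmProb P H L Λ σ γ Δθ e =
      (noncentralChiSq (Λ.card / 2) (‖(attackProj H L Λ).toEuclideanLin
        (σ⁻¹ • (loadMatrix H L).toEuclideanLin Δθ)‖ ^ 2 / 2)).real (Set.Ioi γ) := by
  set m := (loadMatrix H L).toEuclideanLin Δθ
  have hcont : Continuous (attackProj H L Λ).toEuclideanLin :=
    (attackProj H L Λ).toEuclideanLin.continuous_of_finiteDimensional
  have hT : Measurable fun y => glrtStat H L Λ σ (m + y) := by
    unfold glrtStat
    fun_prop
  -- The factor $\sigma^2$ from the rescaling cancels the $\sigma^{-2}$ in the statistic.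
  have hscale : ∀ x, glrtStat H L Λ σ (m + σ • x) =
      ‖(attackProj H L Λ).toEuclideanLin (σ⁻¹ • m + x)‖ ^ 2 := by
    intro x
    have : m + σ • x = σ • (σ⁻¹ • m + x) := by rw [smul_add, smul_inv_smul₀ hσ.ne']
    rw [glrtStat, this, map_smul, norm_smul, mul_pow, Real.norm_eq_abs, sq_abs]
    field_simp
  have hset : MeasurableSet {y | γ < glrtStat H L Λ σ (m + y)} := hT measurableSet_Ioi
  rw [← trace_attackProj hrank, ← map_norm_sq_projection_stdGaussian
    (attackProj_isHermitian H L Λ) (attackProj_mul_self hrank), falseAlarmProb,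
    measureReal_def, measureReal_def,
    Measure.map_apply (by fun_prop) measurableSet_Ioi]
  have : P {ω | γ < glrtStat H L Λ σ (nullMeasurement H L Δθ e ω)} =
      P.map e {y | γ < glrtStat H L Λ σ (m + y)} :=
    (Measure.map_apply_of_aemeasurable he.aemeasurable hset).symm
  rw [this, he.map_eq, multivariateGaussian_zero_smul_one hσ.le,
    Measure.map_apply (by fun_prop) hset]
  congr 2
  ext x
  simp [hscale]

end AttackProjection

end FDI

theorem proposition2 {M V Ω : Type*} [Fintype M] [DecidableEq M] [Fintype V] [DecidableEq V]
    [MeasurableSpace Ω] (P : Measure Ω) [IsProbabilityMeasure P]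
    (H : Matrix M V ℝ) (L : Finset M) (Λ : Finset V) (hΛ : Λ.Nonempty)
    (hrank : LinearIndependent ℝ (FDI.attackMatrix H L Λ).col)
    (σ η γ : ℝ) (hσ : 0 < σ) (hγ : 0 ≤ γ)
    (e : Ω → EuclideanSpace ℝ L)
    (he : HasLaw e (multivariateGaussian 0 (σ ^ 2 • (1 : Matrix L L ℝ))) P)
    (Δθ : EuclideanSpace ℝ V)
    (hη : ‖(FDI.loadMatrix H L).toEuclideanLin Δθ‖ ^ 2 < η) :
    (∀ (x : EuclideanSpace ℝ V) (z : EuclideanSpace ℝ L),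
        (FDI.attackProj H L Λ).toEuclideanLin ((FDI.loadMatrix H L).toEuclideanLin x) = 0 →
        FDI.logGLR H L Λ σ x z = FDI.glrtStat H L Λ σ z) ∧
      FDI.marcumQ ((Λ.card : ℝ) / 2) 0 (Real.sqrt γ)
        ≤ FDI.falseAlarmProb P H L Λ σ γ Δθ e ∧
      FDI.falseAlarmProb P H L Λ σ γ Δθ e
        ≤ FDI.marcumQ ((Λ.card : ℝ) / 2) (Real.sqrt η / σ) (Real.sqrt γ) := by
  have hk : (0 : ℝ) < (Λ.card : ℝ) / 2 := by
    have := hΛ.card_pos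
    positivity
  have hη0 : 0 ≤ η := (sq_nonneg _).trans hη.le
  refine ⟨fun x z hx => FDI.logGLR_eq_glrtStat hrank hσ hx z, ?_, ?_⟩
  · rw [FDI.falseAlarmProb_eq_noncentralChiSq hrank hσ he,
      FDI.marcumQ_eq_noncentralChiSq hk le_rfl (Real.sqrt_nonneg _), Real.sq_sqrt hγ]
    exact FDI.noncentralChiSq_Ioi_mono hk.le (by norm_num) (by simp; positivity) _
  · rw [FDI.falseAlarmProb_eq_noncentralChiSq hrank hσ he,
      FDI.marcumQ_eq_noncentralChiSq hk (by positivity) (Real.sqrt_nonneg _), Real.sq_sqrt hγ]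
    refine FDI.noncentralChiSq_Ioi_mono hk.le (by positivity) ?_ _
    -- A projection does not increase norms, so the noncentrality is at most $\|H_{\mathcal
    -- L,\mathcal V}\Delta\theta\|^2/\sigma^2$, even when $P_\Lambda H_{\mathcal L,\mathcal
    -- V}\Delta\theta\ne 0$.
    refine div_le_div_of_nonneg_right ?_ two_pos.le
    refine (FDI.norm_projection_le (FDI.attackProj_isHermitian H L Λ)
      (FDI.attackProj_mul_self hrank) _).trans ?_
    rw [norm_smul, mul_pow, div_pow, Real.sq_sqrt hη0, norm_inv, Real.norm_of_nonneg hσ.le,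
      inv_pow, inv_mul_eq_div]
    gcongr
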